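/- **Theorem 1.** There are $n$ agents. Agent $i$ owns finitely many original arms $o_{i,1},\dots,o_{i,l(i)}$ with Bernoulli rewards of means $\mu(o_{i,k})\in[0,1]$. A strategy $\mathcal S_i$ of agent $i$ registers, for each $k$, a number $c_{i,k}\ge 0$ of copies of $o_{i,k}$ (the original included), each copy having the reward distribution of $o_{i,k}$; $\mathcal S'_i\supseteq\mathcal S_i$ means $c'_{i,k}\ge c_{i,k}$ for all $k$. For $T$ rounds the principal runs UCB1 on all registered arms: in round $t$ it plays a never-played arm if there is one, and otherwise an arm $a$ maximizing $r(a)+\sqrt{2\ln t/n(a)}$, where $n(a)$ is the number of previous plays of $a$ and $r(a)$ its empirical mean reward; in both cases the choice among the eligible arms is uniformly random. Let $A_t$ be the arm played in round $t$ and $R_t\in\{0,1\}$ its reward, drawn independently given $A_t$. Let $U:\mathbb R_{\ge0}\to\mathbb R_{\ge0}$ be strictly increasing, and let $\gamma_1\ge\gamma_2\ge\dots\ge\gamma_T\ge0$ be a discount sequence with at least $n$ nonzero terms (for instance $\gamma\equiv1$, and $U$ the identity). The expected utility of agent $i$ under the profile $\mathcal S=(\mathcal S_i,\mathcal S_{-i})$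 is $$u_i(\mathcal S)=\mathbb E\Big[U\Big(\sum_{t=1}^T\gamma_t R_t\,\mathbf 1[A_t\in\mathcal S_i]\Big)\Big].$$ If $T\ge n$, then UCB1 is replication-prone: for every agent $i$ that owns an arm of positive mean, and for every profile $\mathcal S$ in which at least one agent other than $i$ registers an arm, there is a strategy $\mathcal S'_i\supseteq\mathcal S_i$ of agent $i$ with $$u_i(\mathcal S'_i,\mathcal S_{-i})>u_i(\mathcal S_i,\mathcal S_{-i}).$$ Moreover, if $\mathcal S_i$ contains an arm of positive mean, then $\mathcal S'_i$ can be chosen to add to $\mathcal S_i$ only finitely many further copies of arms already registered in $\mathcal S_i$. -/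

import Mathlib

open scoped NNReal ENNReal

noncomputable section

namespace ReplicationBandit

/-- A strategy profile of `n` agents, where agent `i` owns the original arms `(i, k)`, `k : Fin (l i)`:
`S i k` is the number `c_{i,k}` of registered copies of the original arm `(i, k)` (the original
included); `S i k = 0` means that this arm is not registered. -/
abbrev Profile {n : ℕ} (l : Fin n → ℕ) : Type := (i : Fin n) → Fin (l i) → ℕ

/-- The arms registered under `S`: triples (agent, original arm, number of the copy). -/
abbrev RegisteredArm {n : ℕ} {l : Fin n → ℕ} (S : Profile l) : Type :=
  Σ i : Fin n, Σ k : Fin (l i), Fin (S i k)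

/-- The finite history of a bandit process: the pairs (selected arm, Bernoulli reward), with the
most recent round first. Thus the head of `x :: h` belongs to round `h.length + 1`. -/
abbrev History (A : Type) : Type := List (A × Bool)

/-- A (randomized) bandit algorithm: it is shown the finite nonempty set `A` of registered arms
with the agent that owns each of them, and, given the history, it draws the next arm. -/
abbrev Algorithm (n : ℕ) : Type 1 :=
  (A : Type) → [Fintype A] → [DecidableEq A] → [Nonempty A] → (A → Fin n) → History A → PMF A

section UCB

variable {A : Type} [DecidableEq A]

/-- The number of times that arm `a` was selected. -/
def pullCount (h : History A) (a : A) : ℕ := (h.filter (fun x => x.1 = a)).length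

/-- The total reward received from arm `a`. -/
def totalReward (h : History A) (a : A) : ℕ := (h.filter (fun x => x.1 = a ∧ x.2 = true)).length

/-- The UCB1 index `r(a) + √(2 ln t / n(a))` of an arm that was selected before, in round
`t = h.length + 1`. -/
def ucbIndex (h : History A) (a : A) : ℝ :=
  (totalReward h a : ℝ) / (pullCount h a : ℝ) +
    Real.sqrt (2 * Real.log ((h.length : ℝ) + 1) / (pullCount h a : ℝ))

variable [Fintype A]

/-- The arms that were never selected. -/
def unexplored (h : History A) : Finset A := Finset.univ.filter (fun a => pullCount h a = 0)

/-- The arms among which UCB1 chooses: the unexplored arms as long as there are any, then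
the maximizers of the index. -/
def ucbCandidates (h : History A) : Finset A :=
  if (unexplored h).Nonempty then unexplored h
  else Finset.univ.filter (fun a => ∀ b, ucbIndex h b ≤ ucbIndex h a)

theorem ucbCandidates_nonempty [Nonempty A] (h : History A) : (ucbCandidates h).Nonempty := by
  unfold ucbCandidates
  split_ifs with hu
  · exact hu
  · obtain ⟨a, ha⟩ := Finite.exists_max (ucbIndex h)
    exact ⟨a, by simpa using ha⟩

end UCB

/-- UCB1, with all ties (also those among the unexplored arms) broken uniformly at random. It
ignores the owners of the arms. -/
def ucb1 {n : ℕ} : Algorithm n := fun _ _ _ _ _ h =>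
  PMF.uniformOfFinset (ucbCandidates h) (ucbCandidates_nonempty h)

/-- The Bernoulli distribution of mean `p`; `true` is the reward `1` and `false` the reward `0`. -/
def bernoulliReward (p : unitInterval) : PMF Bool :=
  PMF.ofFintype (fun b => cond b (ENNReal.ofReal p) (ENNReal.ofReal (1 - p))) (by
    have h0 : (0 : ℝ) ≤ p := p.2.1
    have h1 : (0 : ℝ) ≤ 1 - p := sub_nonneg.2 p.2.2
    simp [← ENNReal.ofReal_add h0 h1])

/-- The law of the first `t` rounds, if arms are selected by `policy` and the reward of a selected
arm `a` is drawn independently from the Bernoulli distribution of mean `mean a`. -/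
def historyLaw {A : Type} (policy : History A → PMF A) (mean : A → unitInterval) :
    ℕ → PMF (History A)
  | 0 => PMF.pure []
  | t + 1 => (historyLaw policy mean t).bind fun h =>
      (policy h).bind fun a => (bernoulliReward (mean a)).bind fun r => PMF.pure ((a, r) :: h)

/-- The discounted revenue `∑_t γ_t R_t 1[A_t belongs to agent i]` along a history. -/
def revenue {n : ℕ} {A : Type} (owner : A → Fin n) (γ : ℕ → ℝ≥0) (i : Fin n) : History A → ℝ≥0
  | [] => 0
  | (a, r) :: h =>
      revenue owner γ i h + (if owner a = i ∧ r = true then γ (h.length + 1) else 0)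

open Classical in
/-- The expected utility `u_i(S) = 𝔼[U(v_i(S))]` of agent `i` over `T` rounds, as the expectation
of a nonnegative function. If no arm at all is registered, nothing is played and the revenue
is `0`. -/
def expectedUtility {n : ℕ} (alg : Algorithm n) (T : ℕ) (γ : ℕ → ℝ≥0) (U : ℝ≥0 → ℝ≥0)
    {l : Fin n → ℕ} (μ : (i : Fin n) → Fin (l i) → unitInterval) (i : Fin n) (S : Profile l) :
    ℝ≥0∞ :=
  if _ne : Nonempty (RegisteredArm S) then
    ∑' h : History (RegisteredArm S),
      historyLaw (alg (RegisteredArm S) (fun a => a.1)) (fun a => μ a.1 a.2.1) T h *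
        (U (revenue (fun a : RegisteredArm S => a.1) γ i h) : ℝ≥0∞)
  else (U 0 : ℝ≥0∞)

/-- Proper discount sequences `γ_1, …, γ_T` for `n` agents: nonnegative, nonincreasing, with at
least `n` nonzero terms. Values of `γ` outside `{1, …, T}` are irrelevant. -/
def IsProperDiscount (n T : ℕ) (γ : ℕ → ℝ≥0) : Prop :=
  AntitoneOn γ (Set.Icc 1 T) ∧ n ≤ ((Finset.Icc 1 T).filter (fun t => γ t ≠ 0)).card

/-- At the profile `S`, agent `i` has a strategy `S'_i ⊇ S_i` of strictly higher expected
utility, the others' strategies being fixed. An algorithm is replication-prone if this holds for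
every agent and every profile. -/
def ProneAt {n : ℕ} (alg : Algorithm n) (T : ℕ) (γ : ℕ → ℝ≥0) (U : ℝ≥0 → ℝ≥0)
    {l : Fin n → ℕ} (μ : (i : Fin n) → Fin (l i) → unitInterval) (i : Fin n) (S : Profile l) :
    Prop :=
  ∃ S'i : Fin (l i) → ℕ, S i ≤ S'i ∧
    expectedUtility alg T γ U μ i S < expectedUtility alg T γ U μ i (Function.update S i S'i)

/-- The same as `ProneAt`, with a strategy `S'_i ⊇ S_i` that adds nothing but further copies of
arms already registered in `S_i`. -/
def PurelyProneAt {n : ℕ} (alg : Algorithm n) (T : ℕ) (γ : ℕ → ℝ≥0) (U : ℝ≥0 → ℝ≥0)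
    {l : Fin n → ℕ} (μ : (i : Fin n) → Fin (l i) → unitInterval) (i : Fin n) (S : Profile l) :
    Prop :=
  ∃ S'i : Fin (l i) → ℕ, S i ≤ S'i ∧ (∀ k, S i k = 0 → S'i k = 0) ∧
    expectedUtility alg T γ U μ i S < expectedUtility alg T γ U μ i (Function.update S i S'i)

end ReplicationBandit

end

namespace ReplicationBandit

/-! Let `p > 0` be the largest mean available to agent `i`, and compare with the ideal in which an
arm of mean `p` is played in every round (`iidUtility`). This ideal is never reached under `S`: no
arm of the agent is better than `p`, and the first choice is uniform over all registered arms, so a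
competitor's arm takes that round, whose discount is positive, with positive probability
(`historyMean_lt_iidUtility`).

The ideal is approached by replication. With `T + m` further copies of an arm of mean `p`, at least
`m` copies are still unexplored in each of the `T` rounds. UCB1 thus never leaves its exploration
phase, and in each round it plays a copy with probability at least `m / (N + T + m)`, where `N` is
the number of arms registered under `S`. This tends to `1` as `m` grows, so the lower bound of
`pow_mul_iidUtility_le` tends to the ideal and passes the utility under `S`. -/

/-- The expectation of `f` under the law of the first `t` rounds. -/
noncomputable def historyMean {A : Type} (policy : History A → PMF A) (mean : A → unitInterval) (t : ℕ)
    (f : History A → ℝ≥0∞) : ℝ≥0∞ :=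
  ∑' h, historyLaw policy mean t h * f h

/-- The expectation of `g (x + c * R)` for a Bernoulli variable `R` of mean `p`. -/
noncomputable def bernoulliStep (p : unitInterval) (c : ℝ≥0) (g : ℝ≥0 → ℝ≥0) (x : ℝ≥0) : ℝ≥0 :=
  Real.toNNReal (1 - p) * g x + Real.toNNReal p * g (x + c)

/-- The expectation of `g (∑ s ≤ t, γ s * R s)` for independent Bernoulli variables `R s` of
mean `p`. -/
noncomputable def iidUtility (p : unitInterval) (γ : ℕ → ℝ≥0) : ℕ → (ℝ≥0 → ℝ≥0) → ℝ≥0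
  | 0, g => g 0
  | t + 1, g => iidUtility p γ t (bernoulliStep p (γ (t + 1)) g)

theorem tsum_bind_mul {α β : Type} (p : PMF α) (k : α → PMF β) (f : β → ℝ≥0∞) :
    ∑' b, p.bind k b * f b = ∑' a, p a * ∑' b, k a b * f b := by
  simp only [PMF.bind_apply, ← ENNReal.tsum_mul_right, ← ENNReal.tsum_mul_left, ← mul_assoc]
  exact ENNReal.tsum_comm

theorem tsum_pure_mul {β : Type} (b : β) (f : β → ℝ≥0∞) :
    ∑' b', (PMF.pure b) b' * f b' = f b := by
  classical
  rw [tsum_eq_single b (fun b' hb => by simp [PMF.pure_apply, hb])]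
  simp

/-! ### A single Bernoulli reward -/

section Step

theorem bernoulliStep_coe (p : unitInterval) (c : ℝ≥0) (g : ℝ≥0 → ℝ≥0) (x : ℝ≥0) :
    ((bernoulliStep p c g x : ℝ≥0) : ℝ) = (1 - p) * g x + p * g (x + c) := by
  simp [bernoulliStep, Real.coe_toNNReal _ p.2.1, Real.coe_toNNReal _ (sub_nonneg.2 p.2.2)]

theorem bernoulliStep_mono_mean {p q : unitInterval} (hpq : p ≤ q) (c : ℝ≥0) {g : ℝ≥0 → ℝ≥0}
    (hg : Monotone g) (x : ℝ≥0) : bernoulliStep p c g x ≤ bernoulliStep q c g x := by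
  rw [← NNReal.coe_le_coe, bernoulliStep_coe, bernoulliStep_coe]
  have h1 : (g x : ℝ) ≤ g (x + c) := NNReal.coe_le_coe.2 (hg le_self_add)
  have h2 : (p : ℝ) ≤ q := hpq
  nlinarith [mul_nonneg (sub_nonneg.2 h1) (sub_nonneg.2 h2)]

theorem le_bernoulliStep (p : unitInterval) (c : ℝ≥0) {g : ℝ≥0 → ℝ≥0}
    (hg : Monotone g) (x : ℝ≥0) : g x ≤ bernoulliStep p c g x := by
  rw [← NNReal.coe_le_coe, bernoulliStep_coe]
  have h1 : (g x : ℝ) ≤ g (x + c) := NNReal.coe_le_coe.2 (hg le_self_add)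
  nlinarith [mul_nonneg (sub_nonneg.2 h1) p.2.1]

theorem lt_bernoulliStep {p : unitInterval} (hp : 0 < p) {c : ℝ≥0} (hc : 0 < c) {g : ℝ≥0 → ℝ≥0}
    (hg : StrictMono g) (x : ℝ≥0) : g x < bernoulliStep p c g x := by
  rw [← NNReal.coe_lt_coe, bernoulliStep_coe]
  have h1 : (g x : ℝ) < g (x + c) := NNReal.coe_lt_coe.2 (hg (lt_add_of_pos_right x hc))
  have h2 : (0 : ℝ) < p := hp
  nlinarith [mul_pos (sub_pos.2 h1) h2]

theorem bernoulliStep_strictMono (p : unitInterval) (c : ℝ≥0) {g : ℝ≥0 → ℝ≥0}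
    (hg : StrictMono g) : StrictMono (bernoulliStep p c g) := by
  intro x y hxy
  rw [← NNReal.coe_lt_coe, bernoulliStep_coe, bernoulliStep_coe]
  have h1 : (g x : ℝ) < g y := NNReal.coe_lt_coe.2 (hg hxy)
  have h2 : (g (x + c) : ℝ) < g (y + c) := NNReal.coe_lt_coe.2 (hg (by gcongr))
  -- For `p = 0` strictness can only come from the term without reward.
  rcases p.2.1.eq_or_lt with h0 | h0
  · rw [← h0]
    linarith
  · nlinarith [mul_pos (sub_pos.2 h2) h0, mul_nonneg (sub_pos.2 h1).le (sub_nonneg.2 p.2.2)]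

end Step

/-! ### Expectations over histories -/

section HistoryMean

variable {A : Type} (policy : History A → PMF A) (mean : A → unitInterval)

theorem historyMean_zero (f : History A → ℝ≥0∞) : historyMean policy mean 0 f = f [] :=
  tsum_pure_mul _ _

theorem historyMean_succ (t : ℕ) (f : History A → ℝ≥0∞) :
    historyMean policy mean (t + 1) f = historyMean policy mean t fun h =>
      ∑' a, policy h a * (ENNReal.ofReal (1 - mean a) * f ((a, false) :: h) +
        ENNReal.ofReal (mean a) * f ((a, true) :: h)) := by
  simp only [historyMean, historyLaw, tsum_bind_mul, tsum_pure_mul]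
  congr! 7 with h a
  rw [tsum_bool]
  simp [bernoulliReward]

/-- This allows the discount `γ (h.length + 1)` to be treated as the constant `γ (t + 1)` under the
law of `t` rounds. -/
theorem length_of_historyLaw_ne_zero (t : ℕ) (h : History A)
    (hh : historyLaw policy mean t h ≠ 0) : h.length = t := by
  induction t generalizing h with
  | zero =>
    have : h ∈ (PMF.pure ([] : History A)).support := hh
    simp_all
  | succ t ih =>
    have : h ∈ (historyLaw policy mean (t + 1)).support := hh
    simp only [historyLaw, PMF.mem_support_bind_iff, PMF.mem_support_pure_iff] at this
    obtain ⟨h', hh', a, -, r, -, rfl⟩ := this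
    simpa using ih h' hh'

variable {policy mean}

theorem historyMean_mono {t : ℕ} {f f' : History A → ℝ≥0∞}
    (hf : ∀ h : History A, h.length = t → f h ≤ f' h) :
    historyMean policy mean t f ≤ historyMean policy mean t f' := by
  refine ENNReal.tsum_le_tsum fun h => ?_
  by_cases hh : historyLaw policy mean t h = 0
  · simp [hh]
  · gcongr
    exact hf h (length_of_historyLaw_ne_zero policy mean t h hh)

theorem historyMean_const_mul (t : ℕ) (c : ℝ≥0∞) (f : History A → ℝ≥0∞) :
    historyMean policy mean t (fun h => c * f h) = c * historyMean policy mean t f := by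
  simp only [historyMean, ← ENNReal.tsum_mul_left]
  congr! 2
  ring

end HistoryMean

/-! ### Comparison with an arm played in every round -/

section Revenue

variable {n : ℕ} {A : Type} (owner : A → Fin n) (γ : ℕ → ℝ≥0) (i : Fin n)
  {policy : History A → PMF A} {mean : A → unitInterval}

/-- The mean utility of agent `i` after the next round, if arm `a` is selected in it. -/
theorem next_round_utility (mean : A → unitInterval) (g : ℝ≥0 → ℝ≥0) (h : History A) (a : A) :
    ENNReal.ofReal (1 - mean a) * (g (revenue owner γ i ((a, false) :: h)) : ℝ≥0∞) +
      ENNReal.ofReal (mean a) * (g (revenue owner γ i ((a, true) :: h)) : ℝ≥0∞) =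
    (if owner a = i then
      bernoulliStep (mean a) (γ (h.length + 1)) g (revenue owner γ i h)
      else g (revenue owner γ i h) : ℝ≥0) := by
  split_ifs with ha
  · simp [revenue, bernoulliStep, ha, ENNReal.ofReal]
  · simp only [revenue, ha, false_and, if_false, add_zero]
    rw [← add_mul, ← ENNReal.ofReal_add (sub_nonneg.2 (mean a).2.2) (mean a).2.1]
    simp

theorem historyMean_revenue_succ (t : ℕ) (g : ℝ≥0 → ℝ≥0) :
    historyMean policy mean (t + 1) (fun h => (g (revenue owner γ i h) : ℝ≥0∞)) =
      historyMean policy mean t fun h => ∑' a, policy h a * ((if owner a = i then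
        bernoulliStep (mean a) (γ (h.length + 1)) g (revenue owner γ i h)
        else g (revenue owner γ i h) : ℝ≥0) : ℝ≥0∞) := by
  rw [historyMean_succ]
  simp only [next_round_utility]

theorem next_round_utility_le {p : unitInterval} (hp : ∀ a, owner a = i → mean a ≤ p)
    {g : ℝ≥0 → ℝ≥0} (hg : Monotone g) (c x : ℝ≥0) (a : A) :
    (if owner a = i then bernoulliStep (mean a) c g x else g x) ≤ bernoulliStep p c g x := by
  split_ifs with ha
  · exact bernoulliStep_mono_mean (hp a ha) c hg x
  · exact le_bernoulliStep p c hg x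

/-- If all arms of agent `i` have mean at most `p` and some arm of another agent may be selected
in the first round, then agent `i` does strictly worse than with an arm of mean `p` played in
every round. -/
theorem historyMean_lt_iidUtility {p : unitInterval} (hp : ∀ a, owner a = i → mean a ≤ p)
    (hp0 : 0 < p) (hγ : 0 < γ 1) {b : A} (hb : owner b ≠ i) (hb0 : policy [] b ≠ 0)
    (t : ℕ) {g : ℝ≥0 → ℝ≥0} (hg : StrictMono g) :
    historyMean policy mean (t + 1) (fun h => (g (revenue owner γ i h) : ℝ≥0∞)) <
      iidUtility p γ (t + 1) g := by
  -- The last round is absorbed into `g`, which stays strictly monotone. The strict gap arises in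
  -- the first round, the base case.
  induction t generalizing g with
  | zero =>
    rw [historyMean_revenue_succ, historyMean_zero]
    simp only [revenue, List.length_nil, zero_add, iidUtility]
    have hsum : ∑' a, policy [] a * (bernoulliStep p (γ 1) g 0 : ℝ≥0∞) =
        bernoulliStep p (γ 1) g 0 := by
      rw [ENNReal.tsum_mul_right, (policy []).tsum_coe, one_mul]
    have hle : ∀ a, policy [] a * ((if owner a = i then bernoulliStep (mean a) (γ 1) g 0
        else g 0 : ℝ≥0) : ℝ≥0∞) ≤ policy [] a * (bernoulliStep p (γ 1) g 0 : ℝ≥0∞) := by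
      intro a
      gcongr
      exact next_round_utility_le owner i hp hg.monotone _ _ a
    refine (ENNReal.tsum_lt_tsum (i := b) ?_ hle ?_).trans_eq hsum
    · exact ne_top_of_le_ne_top (hsum.trans_ne ENNReal.coe_ne_top) (ENNReal.tsum_le_tsum hle)
    · rw [if_neg hb]
      exact ENNReal.mul_lt_mul_right hb0 ((policy []).apply_ne_top b)
        (ENNReal.coe_lt_coe.2 (lt_bernoulliStep hp0 hγ hg 0))
  | succ t ih =>
    refine lt_of_le_of_lt ?_ (ih (bernoulliStep_strictMono p (γ (t + 1 + 1)) hg))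
    rw [historyMean_revenue_succ]
    refine historyMean_mono fun h hh => ?_
    rw [hh]
    calc _ ≤ ∑' a, policy h a *
          (bernoulliStep p (γ (t + 1 + 1)) g (revenue owner γ i h) : ℝ≥0∞) := by
          refine ENNReal.tsum_le_tsum fun a => ?_
          gcongr
          exact next_round_utility_le owner i hp hg.monotone _ _ a
      _ = _ := by rw [ENNReal.tsum_mul_right, (policy h).tsum_coe, one_mul]

/-- If in each of the first `T` rounds a set `K` of arms of agent `i` that have mean `p` is
selected with probability at least `δ`, then up to the factor `δ ^ T` agent `i` does as well as
with an arm of mean `p` played in every round. -/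
theorem pow_mul_iidUtility_le {p : unitInterval} {T : ℕ} {δ : ℝ≥0∞} (K : Finset A)
    (hK : ∀ a ∈ K, owner a = i ∧ mean a = p)
    (hδ : ∀ h : History A, h.length < T → δ ≤ ∑ a ∈ K, policy h a)
    (t : ℕ) (ht : t ≤ T) (g : ℝ≥0 → ℝ≥0) :
    δ ^ t * iidUtility p γ t g ≤
      historyMean policy mean t (fun h => (g (revenue owner γ i h) : ℝ≥0∞)) := by
  induction t generalizing g with
  | zero => simp [historyMean_zero, iidUtility, revenue]
  | succ t ih =>
    rw [pow_succ', mul_assoc, iidUtility, historyMean_revenue_succ]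
    -- One factor `δ` pays for the last round; the contribution of arms outside `K` is nonnegative
    -- and dropped.
    refine (mul_le_mul_right (ih (by omega) _) δ).trans ?_
    rw [← historyMean_const_mul]
    refine historyMean_mono fun h hh => ?_
    refine (mul_le_mul_left (hδ h (by omega)) _).trans ?_
    rw [Finset.sum_mul]
    refine le_trans (le_of_eq (Finset.sum_congr rfl fun a ha => ?_)) (ENNReal.sum_le_tsum K)
    rw [if_pos (hK a ha).1, (hK a ha).2, hh]

end Revenue

/-! ### The exploration phase of UCB1 -/

section UCB

variable {A : Type} [DecidableEq A]

/-- Each round explores at most one new arm, so a large set of copies is not exhausted within `T`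
rounds. -/
theorem card_explored_le (K : Finset A) (h : History A) :
    (K.filter fun a => pullCount h a ≠ 0).card ≤ h.length := by
  calc _ ≤ (h.map Prod.fst).toFinset.card := by
        refine Finset.card_le_card fun a ha => ?_
        obtain ⟨-, ha⟩ := Finset.mem_filter.1 ha
        obtain ⟨x, hx⟩ := List.exists_mem_of_length_pos (Nat.pos_of_ne_zero ha)
        have := List.mem_filter.1 hx
        simp only [List.mem_toFinset, List.mem_map]
        exact ⟨x, this.1, by simpa using this.2⟩
    _ ≤ _ := by simpa using (h.map Prod.fst).toFinset_card_le

variable [Fintype A]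

/-- As long as fewer than `K.card` rounds were played, UCB1 explores, and it selects an arm of `K`
with probability at least `(K.card - h.length) / Fintype.card A`. -/
theorem div_le_sum_ucb1 {n : ℕ} [Nonempty A] (owner : A → Fin n) (K : Finset A) (h : History A)
    (hK : h.length < K.card) :
    ((K.card - h.length : ℕ) : ℝ≥0∞) / Fintype.card A ≤ ∑ a ∈ K, ucb1 A owner h a := by
  have hcard : (K.filter fun a => pullCount h a = 0).card +
      (K.filter fun a => pullCount h a ≠ 0).card = K.card :=
    K.card_filter_add_card_filter_not _
  have hexp := card_explored_le K h
  have hsub : K.filter (fun a => pullCount h a = 0) ⊆ unexplored h := fun a ha => by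
    simpa [unexplored] using (Finset.mem_filter.1 ha).2
  have hne : (unexplored h).Nonempty :=
    Finset.Nonempty.mono hsub (Finset.card_pos.1 (by omega))
  have hcand : ucbCandidates h = unexplored h := if_pos hne
  have hval : ∀ a ∈ K.filter (fun a => pullCount h a = 0),
      ucb1 A owner h a = ((unexplored h).card : ℝ≥0∞)⁻¹ := fun a ha => by
    rw [ucb1, PMF.uniformOfFinset_apply_of_mem _ (hcand ▸ hsub ha), hcand]
  calc _ ≤ ((K.filter fun a => pullCount h a = 0).card : ℝ≥0∞) / (unexplored h).card := by
        gcongr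
        · omega
        · exact Finset.card_le_univ _
    _ = ∑ a ∈ K.filter (fun a => pullCount h a = 0), ucb1 A owner h a := by
        rw [Finset.sum_congr rfl hval, Finset.sum_const, nsmul_eq_mul, div_eq_mul_inv]
    _ ≤ _ := Finset.sum_le_sum_of_subset (Finset.filter_subset _ _)

theorem ucb1_nil_ne_zero {n : ℕ} [Nonempty A] (owner : A → Fin n) (a : A) :
    ucb1 A owner [] a ≠ 0 := by
  have ha : a ∈ unexplored ([] : History A) := by simp [unexplored, pullCount]
  have hcand : ucbCandidates ([] : History A) = unexplored [] := if_pos ⟨a, ha⟩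
  rw [← PMF.mem_support_iff, ucb1, PMF.mem_support_uniformOfFinset_iff, hcand]
  exact ha

end UCB

/-! ### Adding copies -/

section Replication

variable {n : ℕ} {l : Fin n → ℕ}

/-- The strategy of agent `i` that adds `c` copies of the original arm `k` to `S i`. -/
def addCopies (S : Profile l) (i : Fin n) (k : Fin (l i)) (c : ℕ) : Fin (l i) → ℕ :=
  Function.update (S i) k (S i k + c)

theorem le_addCopies (S : Profile l) (i : Fin n) (k : Fin (l i)) (c : ℕ) :
    S i ≤ addCopies S i k c := by
  intro k'
  rcases eq_or_ne k' k with rfl | hk <;> simp [addCopies, *]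

theorem card_registeredArm_addCopies (S : Profile l) (i : Fin n) (k : Fin (l i)) (c : ℕ) :
    Fintype.card (RegisteredArm (Function.update S i (addCopies S i k c))) =
      Fintype.card (RegisteredArm S) + c := by
  have hi : ∑ k', addCopies S i k c k' = ∑ k', S i k' + c := by
    rw [addCopies, Finset.sum_update_of_mem (Finset.mem_univ k),
      ← Finset.sum_sdiff (Finset.subset_univ {k}), Finset.sum_singleton]
    omega
  simp only [Fintype.card_sigma, Fintype.card_fin]
  have hrest : ∑ j ∈ Finset.univ.erase i, ∑ k', Function.update S i (addCopies S i k c) j k' =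
      ∑ j ∈ Finset.univ.erase i, ∑ k', S j k' :=
    Finset.sum_congr rfl fun j hj => by rw [Function.update_of_ne (Finset.ne_of_mem_erase hj)]
  rw [← Finset.add_sum_erase _ _ (Finset.mem_univ i),
    ← Finset.add_sum_erase Finset.univ (fun j => ∑ k, S j k) (Finset.mem_univ i),
    Function.update_self, hi, hrest]
  omega

/-- The registered copies of the original arm `k` of agent `i`. -/
def copies (S : Profile l) (i : Fin n) (k : Fin (l i)) : Finset (RegisteredArm S) :=
  Finset.univ.map ⟨fun m : Fin (S i k) => ⟨i, k, m⟩, fun m m' h => by simpa using h⟩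

/-- The existential hides the classical instance chosen in `expectedUtility`; the bounds above hold
for any instance. -/
theorem expectedUtility_eq_historyMean (alg : Algorithm n) (T : ℕ) (γ : ℕ → ℝ≥0)
    (U : ℝ≥0 → ℝ≥0) (μ : (i : Fin n) → Fin (l i) → unitInterval) (i : Fin n) (S : Profile l)
    [ne : Nonempty (RegisteredArm S)] :
    ∃ _ : DecidableEq (RegisteredArm S), expectedUtility alg T γ U μ i S =
      historyMean (alg (RegisteredArm S) fun a => a.1) (fun a => μ a.1 a.2.1) T
        fun h => (U (revenue (fun a : RegisteredArm S => a.1) γ i h) : ℝ≥0∞) :=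
  ⟨_, dif_pos ne⟩

/-- An upper bound of the utility under a profile in which another agent competes. -/
theorem expectedUtility_lt_iidUtility (T : ℕ) {γ : ℕ → ℝ≥0} (hγ : 0 < γ 1)
    {U : ℝ≥0 → ℝ≥0} (hU : StrictMono U) {μ : (i : Fin n) → Fin (l i) → unitInterval} {i : Fin n}
    {S : Profile l} {p : unitInterval} (hp0 : 0 < p) (hp : ∀ k, 0 < S i k → μ i k ≤ p)
    (hother : ∃ j, j ≠ i ∧ ∃ k, 0 < S j k) :
    expectedUtility ucb1 (T + 1) γ U μ i S < iidUtility p γ (T + 1) U := by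
  obtain ⟨j, hj, k, hk⟩ := hother
  let b : RegisteredArm S := ⟨j, k, ⟨0, hk⟩⟩
  have : Nonempty (RegisteredArm S) := ⟨b⟩
  obtain ⟨_, h⟩ := expectedUtility_eq_historyMean ucb1 (T + 1) γ U μ i S
  rw [h]
  refine historyMean_lt_iidUtility _ γ i ?_ hp0 hγ (b := b) hj (ucb1_nil_ne_zero _ b) T hU
  rintro ⟨i', k', m⟩ rfl
  exact hp k' m.pos

/-- A lower bound of the utility after adding `T + m` copies of an arm of agent `i`. -/
theorem pow_mul_iidUtility_le_expectedUtility (T m : ℕ) (γ : ℕ → ℝ≥0) (U : ℝ≥0 → ℝ≥0)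
    (μ : (i : Fin n) → Fin (l i) → unitInterval) (i : Fin n) (S : Profile l) (k : Fin (l i))
    (hm : 0 < m) :
    ((m : ℝ≥0∞) / (Fintype.card (RegisteredArm S) + (T + m) : ℕ)) ^ T *
        iidUtility (μ i k) γ T U ≤
      expectedUtility ucb1 T γ U μ i (Function.update S i (addCopies S i k (T + m))) := by
  set S' := Function.update S i (addCopies S i k (T + m)) with hS'
  have hk : S' i k = S i k + (T + m) := by simp [hS', addCopies]
  have hcard : (copies S' i k).card = S i k + (T + m) := by simp [copies, hk]
  have : Nonempty (RegisteredArm S') := ⟨⟨i, k, ⟨0, by omega⟩⟩⟩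
  obtain ⟨_, h⟩ := expectedUtility_eq_historyMean ucb1 T γ U μ i S'
  rw [h, ← card_registeredArm_addCopies S i k]
  refine pow_mul_iidUtility_le _ γ i (T := T) (copies S' i k) ?_ (fun h hh => ?_) T le_rfl U
  · intro a ha
    obtain ⟨m, -, rfl⟩ := Finset.mem_map.1 ha
    exact ⟨rfl, rfl⟩
  -- Fewer than `T` of the at least `T + m` copies have been played, which leaves `m`.
  · refine le_trans ?_ (div_le_sum_ucb1 _ (copies S' i k) h (by omega))
    gcongr
    omega

theorem exists_lt_expectedUtility_addCopies (T : ℕ) (γ : ℕ → ℝ≥0) (U : ℝ≥0 → ℝ≥0)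
    (μ : (i : Fin n) → Fin (l i) → unitInterval) (i : Fin n) (S : Profile l) (k : Fin (l i))
    {v : ℝ≥0∞} (hv : v < iidUtility (μ i k) γ T U) :
    ∃ c, v < expectedUtility ucb1 T γ U μ i (Function.update S i (addCopies S i k c)) := by
  have hlim : Filter.Tendsto (fun m : ℕ =>
      ((m : ℝ≥0∞) / (Fintype.card (RegisteredArm S) + (T + m) : ℕ)) ^ T *
        iidUtility (μ i k) γ T U) Filter.atTop (nhds (1 ^ T * iidUtility (μ i k) γ T U)) := by
    refine ENNReal.Tendsto.mul_const (ENNReal.Tendsto.pow ?_) (Or.inr ENNReal.coe_ne_top)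
    have hreal := ENNReal.tendsto_ofReal
      (tendsto_natCast_div_add_atTop ((Fintype.card (RegisteredArm S) + T : ℕ) : ℝ))
    rw [ENNReal.ofReal_one] at hreal
    refine hreal.congr' ?_
    filter_upwards [Filter.eventually_gt_atTop 0] with m hm
    rw [ENNReal.ofReal_div_of_pos (by positivity), ENNReal.ofReal_natCast, ← Nat.cast_add,
      ENNReal.ofReal_natCast]
    congr 2
    omega
  rw [one_pow, one_mul] at hlim
  obtain ⟨m, hm, hm0⟩ :=
    ((hlim.eventually (lt_mem_nhds hv)).and (Filter.eventually_gt_atTop 0)).exists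
  exact ⟨T + m, hm.trans_le (pow_mul_iidUtility_le_expectedUtility T m γ U μ i S k hm0)⟩

/-- Some discount is nonzero and the first is the largest. -/
theorem IsProperDiscount.one_pos {T : ℕ} {γ : ℕ → ℝ≥0} (hγ : IsProperDiscount n T γ)
    (hn : 0 < n) : 0 < T ∧ 0 < γ 1 := by
  obtain ⟨t, ht⟩ := Finset.card_pos.1 (hn.trans_le hγ.2)
  obtain ⟨ht, ht0⟩ := Finset.mem_filter.1 ht
  rw [Finset.mem_Icc] at ht
  have hT : 1 ≤ T := ht.1.trans ht.2
  exact ⟨hT, (pos_iff_ne_zero.2 ht0).trans_le (hγ.1 ⟨le_rfl, hT⟩ ht ht.1)⟩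

theorem exists_addCopies_improves {T : ℕ} {γ : ℕ → ℝ≥0} (hγ : IsProperDiscount n T γ)
    {U : ℝ≥0 → ℝ≥0} (hU : StrictMono U) {μ : (i : Fin n) → Fin (l i) → unitInterval} {i : Fin n}
    {S : Profile l} {k : Fin (l i)} (hk0 : 0 < μ i k) (hk : ∀ k', 0 < S i k' → μ i k' ≤ μ i k)
    (hother : ∃ j, j ≠ i ∧ ∃ k, 0 < S j k) :
    ∃ c, expectedUtility ucb1 T γ U μ i S <
      expectedUtility ucb1 T γ U μ i (Function.update S i (addCopies S i k c)) := by
  obtain ⟨hT, hγ1⟩ := hγ.one_pos i.pos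
  obtain ⟨T, rfl⟩ := Nat.exists_eq_succ_of_ne_zero hT.ne'
  exact exists_lt_expectedUtility_addCopies _ γ U μ i S k
    (expectedUtility_lt_iidUtility T hγ1 hU hk0 hk hother)

end Replication

end ReplicationBandit

theorem theorem1 (n T : ℕ) (hT : n ≤ T)
    (γ : ℕ → ℝ≥0) (hγ : ReplicationBandit.IsProperDiscount n T γ)
    (U : ℝ≥0 → ℝ≥0) (hU : StrictMono U)
    (l : Fin n → ℕ) (μ : (i : Fin n) → Fin (l i) → unitInterval)
    (i : Fin n) (S : ReplicationBandit.Profile l)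
    -- the agent owns an arm that is not identically zero
    (hpos : ∃ k, 0 < μ i k)
    -- some other agent registers an arm
    (hother : ∃ j, j ≠ i ∧ ∃ k, 0 < S j k) :
    ReplicationBandit.ProneAt ReplicationBandit.ucb1 T γ U μ i S ∧
      ((∃ k, 0 < S i k ∧ 0 < μ i k) →
        ReplicationBandit.PurelyProneAt ReplicationBandit.ucb1 T γ U μ i S) := by
  constructor
  · obtain ⟨k₀, hk₀⟩ := hpos
    -- The best owned arm is replicated, even if `S` does not register it.
    obtain ⟨k, -, hk⟩ := Finset.exists_max_image Finset.univ (μ i) ⟨k₀, Finset.mem_univ k₀⟩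
    obtain ⟨c, hc⟩ := ReplicationBandit.exists_addCopies_improves hγ hU
      (hk₀.trans_le (hk k₀ (Finset.mem_univ k₀))) (fun k' _ => hk k' (Finset.mem_univ k')) hother
    exact ⟨_, ReplicationBandit.le_addCopies S i k c, hc⟩
  · rintro ⟨k₀, hk₀S, hk₀⟩
    -- The best registered arm suffices, since the upper bound only involves registered arms.
    obtain ⟨k, hkS, hk⟩ := Finset.exists_max_image (Finset.univ.filter fun k => 0 < S i k) (μ i)
      ⟨k₀, by simpa using hk₀S⟩
    obtain ⟨c, hc⟩ := ReplicationBandit.exists_addCopies_improves hγ hU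
      (hk₀.trans_le (hk k₀ (by simpa using hk₀S))) (fun k' hk' => hk k' (by simpa using hk'))
      hother
    refine ⟨_, ReplicationBandit.le_addCopies S i k c, fun k' hk' => ?_, hc⟩
    have hne : k' ≠ k := by
      rintro rfl
      simp [hk'] at hkS
    simpa [ReplicationBandit.addCopies, hne] using hk'
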